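/- For $a>0$, $c\in\mathbb{R}$, $x>0$ let $$\psi(a,c,x)=\frac{1}{\Gamma(a)}\int_0^\infty e^{-xt}t^{a-1}(1+t)^{c-a-1}\,dt$$ be the Tricomi confluent hypergeometric function (of the second kind), extended to real $a\le 0$ by analytic continuation in $a$, i.e. through the relation $\psi(a,c,x)=x\,\psi(a+1,c+1,x)+(a-c+1)\,\psi(a+1,c,x)$. Put $$\Delta_a(x)=\psi^2(a,c,x)-\psi(a-1,c,x)\,\psi(a+1,c,x).$$ (i) If $a>0>c$, then for all $x>0$ $$\frac{1}{1+a-c}\left(1+\frac{x}{2c}\right)\psi^2(a,c,x)<\Delta_a(x)<\frac{2}{x}\,\psi^2(a,c,x),$$ and the left-hand inequality is sharp as $x\to0^+$. (ii) The inequality $\Delta_a(x)<\frac{2}{x}\psi^2(a,c,x)$ holds more generally for all $a>0$, $c<1$ and $x>0$, and it is sharp as $x\to\infty$. (iii) If $a>1$ and $c<-1$, then for all $x>0$ $$\frac{1}{1+a-c}\left(1-\frac{c-a}{c^2(c+1)}x^2\right)\psi^2(a,c,x)<\Delta_a(x),$$ and this inequality is sharp as $x\to0^+$. Here an inequality between $\Delta_a(x)$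 and a bound $B(x)$ is called sharp as $x\to0^+$ (respectively $x\to\infty$) if $\Delta_a(x)\sim B(x)$ in that limit, i.e. $\Delta_a(x)-B(x)=o(B(x))$. -/

import Mathlib

open Filter Topology

/-- Auxiliary family for the Tricomi function. At level `0` it is the integral
`(1 / Γ(a)) ∫₀^∞ e^{-xt} t^{a-1} (1+t)^{c-a-1} dt`, which converges for `a > 0`, `x > 0`.
Level `n + 1` continues it by one more unit in the first parameter through the relation
`ψ(a,c,x) = x ψ(a+1,c+1,x) + (a-c+1) ψ(a+1,c,x)` (integration by parts in the integral), so that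
level `n` gives the analytic continuation in `a` to `a > -n`. -/
noncomputable def tricomiAux : ℕ → ℝ → ℝ → ℝ → ℝ
  | 0, a, c, x => 1 / Real.Gamma a *
      ∫ t in Set.Ioi (0 : ℝ), Real.exp (-(x * t)) * t ^ (a - 1) * (1 + t) ^ (c - a - 1)
  | n + 1, a, c, x =>
      x * tricomiAux n (a + 1) (c + 1) x + (a - c + 1) * tricomiAux n (a + 1) c x

/-- The Tricomi confluent hypergeometric function (of the second kind) `ψ(a, c, x)`, for real
`a`, `c` and `x > 0`. For `a > 0` it is the integral (`⌊1 - a⌋₊ = 0`, see `tricomi_of_pos`);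
for `a ≤ 0` it is the continuation of the integral, by the least number of steps that reaches `a`.
-/
noncomputable def tricomi (a c x : ℝ) : ℝ := tricomiAux ⌊1 - a⌋₊ a c x

theorem tricomi_of_pos {a : ℝ} (ha : 0 < a) (c x : ℝ) :
    tricomi a c x = 1 / Real.Gamma a *
      ∫ t in Set.Ioi (0 : ℝ), Real.exp (-(x * t)) * t ^ (a - 1) * (1 + t) ^ (c - a - 1) := by
  have h : ⌊1 - a⌋₊ = 0 := Nat.floor_eq_zero.2 (by linarith)
  rw [tricomi, h, tricomiAux]

/-- The Turánian in which only the first parameter is shifted: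
`ψ(a,c,x)² - ψ(a-1,c,x) ψ(a+1,c,x)`. -/
noncomputable def turanianFst (a c x : ℝ) : ℝ :=
  tricomi a c x ^ 2 - tricomi (a - 1) c x * tricomi (a + 1) c x

open MeasureTheory Set

/-! Write `A = Γ(a) ψ(a,c,·)` and `B = -A'`, both Laplace-type integrals. Contiguous relations give
`(1+a-c) Δ_a / ψ² = 1 + x² (B/(aA))'`, so every bound on the Turánian is a bound `f` on the slope of
`B/(aA)` (`turanianFst_eq_ratio`).

Let `S = A² (B/(aA))'`. Kummer's equation yields `(x^{c+1} e^{-x} S)' = x^c e^{-x} (B² + AB)/a`, so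
the derivative of `x^{c+1} e^{-x} (S - f A²)` is `x^c e^{-x}` times an explicit quadratic form in
`A`, `B`. The differentiated quantity vanishes at infinity, hence a constant sign of the form
decides between `S` and `f A²` (`slope_lt`, `lt_slope`). The three choices of `f` need only `x B < a
A`, `0 < a A + c B` and `x (aA - xB) < (1+a-c) a A`, all consequences of the positivity of
neighbouring integrals.

Sharpness at `0` follows from `x B/(aA) → 0`. At infinity the leading terms of the ratio cancel, and
an exact contiguous relation supplies the next order. -/

/-- The Laplace-type integral `∫₀^∞ e^{-xt} t^p (1+t)^r dt`. -/
noncomputable def laplaceBeta (p r x : ℝ) : ℝ :=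
  ∫ t in Ioi (0 : ℝ), Real.exp (-(x * t)) * t ^ p * (1 + t) ^ r

/-! ### Laplace-type integrals: convergence, contiguity, derivative. -/

theorem one_add_rpow_le_exp (r : ℝ) {ε : ℝ} (hε : 0 < ε) :
    ∃ C : ℝ, ∀ t : ℝ, 0 < t → (1 + t) ^ r ≤ C * Real.exp (ε * t) := by
  have hR : 0 < max r 0 + 1 := by positivity
  set R := max r 0 + 1 with hRdef
  -- `δ ≤ 1` gives `δ (1 + t) ≤ 1 + δ t ≤ e^{δt}`; `δ R ≤ ε` keeps the rate below `ε` after raising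
  -- to the power `R`.
  set δ := min 1 (ε / R) with hδ
  have hδ0 : 0 < δ := lt_min one_pos (by positivity)
  refine ⟨(1 / δ) ^ R, fun t ht => ?_⟩
  have h1 : 1 + t ≤ 1 / δ * Real.exp (δ * t) := by
    rw [div_mul_eq_mul_div, one_mul, le_div_iff₀ hδ0]
    have := Real.add_one_le_exp (δ * t)
    have : δ ≤ 1 := min_le_left _ _
    nlinarith
  have hrR : r ≤ R := by have := le_max_left r 0; linarith
  calc (1 + t) ^ r ≤ (1 + t) ^ R := Real.rpow_le_rpow_of_exponent_le (by linarith) hrR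
    _ ≤ (1 / δ * Real.exp (δ * t)) ^ R := Real.rpow_le_rpow (by linarith) h1 hR.le
    _ = (1 / δ) ^ R * Real.exp (δ * t * R) := by
      rw [Real.mul_rpow (by positivity) (by positivity), ← Real.exp_mul]
    _ ≤ (1 / δ) ^ R * Real.exp (ε * t) := by
      refine mul_le_mul_of_nonneg_left (Real.exp_le_exp.2 ?_) (by positivity)
      have : δ * R ≤ ε := by
        have := min_le_right 1 (ε / R)
        rwa [← hδ, le_div_iff₀ hR] at this
      calc δ * t * R = δ * R * t := by ring
        _ ≤ ε * t := by gcongr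

theorem aestronglyMeasurable_laplaceBeta (p r x : ℝ) :
    AEStronglyMeasurable (fun t : ℝ => Real.exp (-(x * t)) * t ^ p * (1 + t) ^ r)
      (volume.restrict (Ioi 0)) := by
  refine Measurable.aestronglyMeasurable ?_
  fun_prop

theorem integrableOn_laplaceBeta {p : ℝ} (hp : -1 < p) (r : ℝ) {x : ℝ} (hx : 0 < x) :
    IntegrableOn (fun t : ℝ => Real.exp (-(x * t)) * t ^ p * (1 + t) ^ r) (Ioi 0) := by
  obtain ⟨C, hC⟩ := one_add_rpow_le_exp r (half_pos hx)
  have h := (integrableOn_rpow_mul_exp_neg_mul_rpow hp zero_lt_one (half_pos hx)).const_mul C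
  refine Integrable.mono' h (aestronglyMeasurable_laplaceBeta p r x) ?_
  refine (ae_restrict_iff' measurableSet_Ioi).2 (ae_of_all _ fun t ht => ?_)
  have ht0 : (0 : ℝ) < t := ht
  rw [Real.norm_of_nonneg (by positivity), Real.rpow_one]
  calc Real.exp (-(x * t)) * t ^ p * (1 + t) ^ r
      ≤ Real.exp (-(x * t)) * t ^ p * (C * Real.exp (x / 2 * t)) := by
        gcongr; exact hC t ht0
    _ = C * (t ^ p * (Real.exp (-(x * t)) * Real.exp (x / 2 * t))) := by ring
    _ = C * (t ^ p * Real.exp (-(x / 2) * t)) := by rw [← Real.exp_add]; ring_nf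

theorem laplaceBeta_pos {p : ℝ} (hp : -1 < p) (r : ℝ) {x : ℝ} (hx : 0 < x) :
    0 < laplaceBeta p r x := by
  unfold laplaceBeta
  refine (setIntegral_pos_iff_support_of_nonneg_ae ?_ (integrableOn_laplaceBeta hp r hx)).2 ?_
  · refine (ae_restrict_iff' measurableSet_Ioi).2 (ae_of_all _ fun t ht => ?_)
    have ht0 : (0 : ℝ) < t := ht
    simp only [Pi.zero_apply]
    positivity
  · have : Ioi (0 : ℝ) ⊆ Function.support
        (fun t : ℝ => Real.exp (-(x * t)) * t ^ p * (1 + t) ^ r) ∩ Ioi 0 := fun t ht => by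
      have ht0 : (0 : ℝ) < t := ht
      exact ⟨ne_of_gt (by positivity), ht⟩
    exact lt_of_lt_of_le (by simp) (measure_mono this)

theorem laplaceBeta_add_one_right {p : ℝ} (hp : -1 < p) (r : ℝ) {x : ℝ} (hx : 0 < x) :
    laplaceBeta p (r + 1) x = laplaceBeta p r x + laplaceBeta (p + 1) r x := by
  unfold laplaceBeta
  rw [← integral_add (integrableOn_laplaceBeta hp r hx)
    (integrableOn_laplaceBeta (by linarith) r hx)]
  refine setIntegral_congr_fun measurableSet_Ioi fun t ht => ?_
  have ht0 : (0 : ℝ) < t := ht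
  rw [Real.rpow_add_one (by positivity), Real.rpow_add_one ht0.ne']
  ring

/-- Integration by parts. -/
theorem mul_laplaceBeta {p : ℝ} (hp : 0 < p) (r : ℝ) {x : ℝ} (hx : 0 < x) :
    x * laplaceBeta p r x = p * laplaceBeta (p - 1) r x + r * laplaceBeta p (r - 1) x := by
  have i1 := (integrableOn_laplaceBeta (p := p) (by linarith) r hx)
  have i2 := (integrableOn_laplaceBeta (p := p - 1) (by linarith) r hx)
  have i3 := (integrableOn_laplaceBeta (p := p) (by linarith) (r - 1) hx)
  have hd : ∀ t ∈ Ioi (0 : ℝ), HasDerivAt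
      (fun t : ℝ => Real.exp (-(x * t)) * t ^ p * (1 + t) ^ r)
      (p * (Real.exp (-(x * t)) * t ^ (p - 1) * (1 + t) ^ r)
        + r * (Real.exp (-(x * t)) * t ^ p * (1 + t) ^ (r - 1))
        - x * (Real.exp (-(x * t)) * t ^ p * (1 + t) ^ r)) t := fun t ht => by
    have ht0 : (0 : ℝ) < t := ht
    have e1 : HasDerivAt (fun t : ℝ => Real.exp (-(x * t))) (Real.exp (-(x * t)) * (-(x * 1))) t :=
      (((hasDerivAt_id t).const_mul x).neg).exp
    have e2 : HasDerivAt (fun t : ℝ => t ^ p) (p * t ^ (p - 1)) t :=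
      Real.hasDerivAt_rpow_const (Or.inl ht0.ne')
    have e3 : HasDerivAt (fun t : ℝ => (1 + t) ^ r) (1 * r * (1 + t) ^ (r - 1)) t :=
      ((hasDerivAt_id t).const_add 1).rpow_const (Or.inl (by simp; positivity))
    refine ((e1.mul e2).mul e3).congr_deriv ?_
    simp only [Pi.mul_apply]
    ring
  have hi := ((i2.const_mul p).add (i3.const_mul r)).sub (i1.const_mul x)
  -- The boundary term at infinity vanishes because the function and its derivative are integrable;
  -- the one at `0` vanishes because `p > 0`.
  have hlim := tendsto_zero_of_hasDerivAt_of_integrableOn_Ioi hd hi i1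
  have hcont : ContinuousWithinAt (fun t : ℝ => Real.exp (-(x * t)) * t ^ p * (1 + t) ^ r)
      (Ici 0) 0 := by
    refine ContinuousAt.continuousWithinAt ?_
    refine ContinuousAt.mul (ContinuousAt.mul (by fun_prop) ?_) ?_
    · exact Real.continuousAt_rpow_const _ _ (Or.inr hp.le)
    · exact ContinuousAt.rpow_const (by fun_prop) (Or.inl (by simp))
  have key := integral_Ioi_of_hasDerivAt_of_tendsto hcont hd hi hlim
  have e : (∫ t in Ioi (0 : ℝ), (p * (Real.exp (-(x * t)) * t ^ (p - 1) * (1 + t) ^ r)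
        + r * (Real.exp (-(x * t)) * t ^ p * (1 + t) ^ (r - 1))
        - x * (Real.exp (-(x * t)) * t ^ p * (1 + t) ^ r)))
      = p * laplaceBeta (p - 1) r x + r * laplaceBeta p (r - 1) x - x * laplaceBeta p r x := by
    unfold laplaceBeta
    rw [← integral_const_mul, ← integral_const_mul, ← integral_const_mul]
    rw [← integral_add (i2.const_mul p) (i3.const_mul r)]
    exact integral_sub ((i2.const_mul p).add (i3.const_mul r)) (i1.const_mul x)
  rw [e, Real.zero_rpow hp.ne'] at key
  linarith

theorem hasDerivAt_laplaceBeta {p : ℝ} (hp : -1 < p) (r : ℝ) {x : ℝ} (hx : 0 < x) :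
    HasDerivAt (laplaceBeta p r) (-laplaceBeta (p + 1) r x) x := by
  have hball : Metric.ball x (x / 2) ∈ 𝓝 x := Metric.ball_mem_nhds x (half_pos hx)
  have h := hasDerivAt_integral_of_dominated_loc_of_deriv_le (μ := volume.restrict (Ioi (0 : ℝ)))
    (F := fun x t => Real.exp (-(x * t)) * t ^ p * (1 + t) ^ r)
    (F' := fun x t => -(Real.exp (-(x * t)) * t ^ (p + 1) * (1 + t) ^ r))
    (bound := fun t => Real.exp (-(x / 2 * t)) * t ^ (p + 1) * (1 + t) ^ r)
    hball
    (Eventually.of_forall fun y => aestronglyMeasurable_laplaceBeta p r y)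
    (integrableOn_laplaceBeta hp r hx)
    (aestronglyMeasurable_laplaceBeta (p + 1) r x).neg ?_
    (integrableOn_laplaceBeta (by linarith) r (half_pos hx)) ?_
  · have := h.2
    rw [integral_neg] at this
    exact this
  · refine (ae_restrict_iff' measurableSet_Ioi).2 (ae_of_all _ fun t ht y hy => ?_)
    have ht0 : (0 : ℝ) < t := ht
    rw [norm_neg, Real.norm_of_nonneg (by positivity)]
    have : x / 2 ≤ y := by
      rw [Metric.mem_ball, Real.dist_eq, abs_lt] at hy
      linarith
    gcongr
  · refine (ae_restrict_iff' measurableSet_Ioi).2 (ae_of_all _ fun t ht y hy => ?_)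
    have ht0 : (0 : ℝ) < t := ht
    have e1 : HasDerivAt (fun y : ℝ => Real.exp (-(y * t))) (Real.exp (-(y * t)) * (-(1 * t))) y :=
      (((hasDerivAt_id y).mul_const t).neg).exp
    refine ((e1.mul_const (t ^ p)).mul_const ((1 + t) ^ r)).congr_deriv ?_
    rw [Real.rpow_add_one ht0.ne']
    ring

/-! ### The Turánian in terms of integrals. -/

theorem tricomi_eq_laplaceBeta {a : ℝ} (ha : 0 < a) (c x : ℝ) :
    tricomi a c x = 1 / Real.Gamma a * laplaceBeta (a - 1) (c - a - 1) x :=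
  tricomi_of_pos ha c x

/-- The continuation relation, which below `a = 1` is the definition and above it is an
integration by parts. -/
theorem tricomi_sub_one {a : ℝ} (ha : 0 < a) (c : ℝ) {x : ℝ} (hx : 0 < x) :
    tricomi (a - 1) c x = x * tricomi a (c + 1) x + (a - c) * tricomi a c x := by
  rcases le_or_gt a 1 with h | h
  -- Here `a - 1` lies in `(-1, 0]`, endpoint `0` included, so exactly one continuation step is
  -- taken.
  · have hf : ⌊1 - (a - 1)⌋₊ = 1 := by
      rw [Nat.floor_eq_iff (by linarith)]
      constructor <;> push_cast <;> linarith
    have h0 : ⌊1 - a⌋₊ = 0 := Nat.floor_eq_zero.2 (by linarith)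
    have e : tricomi (a - 1) c x = x * tricomiAux 0 (a - 1 + 1) (c + 1) x
        + (a - 1 - c + 1) * tricomiAux 0 (a - 1 + 1) c x := by rw [tricomi, hf]; rfl
    rw [e, tricomi, h0, tricomi, h0, sub_add_cancel]
    ring
  · rw [tricomi_eq_laplaceBeta ha, tricomi_eq_laplaceBeta ha,
      tricomi_eq_laplaceBeta (by linarith : 0 < a - 1)]
    have hG : Real.Gamma a = (a - 1) * Real.Gamma (a - 1) := by
      conv_lhs => rw [show a = a - 1 + 1 by ring]
      exact Real.Gamma_add_one (by linarith)
    have hG0 : 0 < Real.Gamma (a - 1) := Real.Gamma_pos_of_pos (by linarith)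
    have hip := mul_laplaceBeta (p := a - 1) (by linarith) (c - a) hx
    have ha1 : a - 1 ≠ 0 := by linarith
    rw [show c - (a - 1) - 1 = c - a by ring, show c + 1 - a - 1 = c - a by ring, hG]
    field_simp
    linarith

/-- The Turánian through two contiguous integrals. -/
theorem turanianFst_eq {a c x : ℝ} (ha : 0 < a) (hx : 0 < x) :
    turanianFst a c x = (1 / Real.Gamma a) ^ 2 *
      (laplaceBeta (a - 1) (c - a - 1) x ^ 2
        - (x * (laplaceBeta (a - 1) (c - a - 1) x + laplaceBeta a (c - a - 1) x)
            + (a - c) * laplaceBeta (a - 1) (c - a - 1) x)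
          * (laplaceBeta a (c - a - 1 - 1) x / a)) := by
  have hG0 : 0 < Real.Gamma a := Real.Gamma_pos_of_pos ha
  have h1 := laplaceBeta_add_one_right (p := a - 1) (by linarith) (c - a - 1) hx
  rw [turanianFst, tricomi_sub_one ha c hx, tricomi_eq_laplaceBeta ha, tricomi_eq_laplaceBeta ha,
    tricomi_eq_laplaceBeta (by linarith : 0 < a + 1), Real.Gamma_add_one ha.ne',
    show c + 1 - a - 1 = c - a - 1 + 1 by ring, h1, show a - 1 + 1 = a by ring,
    show a + 1 - 1 = a by ring, show c - (a + 1) - 1 = c - a - 1 - 1 by ring]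
  field_simp

/-! ### Comparison method for Kummer's equation. -/

/-- A strictly increasing function on `(0, ∞)` with limit `0` at infinity is negative. -/
theorem neg_of_hasDerivAt_pos_of_tendsto {M M' : ℝ → ℝ}
    (hd : ∀ x, 0 < x → HasDerivAt M (M' x) x) (hpos : ∀ x, 0 < x → 0 < M' x)
    (hlim : Tendsto M atTop (𝓝 0)) {x : ℝ} (hx : 0 < x) : M x < 0 := by
  have hmono : StrictMonoOn M (Ioi 0) := by
    refine strictMonoOn_of_deriv_pos (convex_Ioi 0)
      (fun y hy => (hd y hy).continuousAt.continuousWithinAt) fun y hy => ?_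
    rw [interior_Ioi] at hy
    rw [(hd y hy).deriv]
    exact hpos y hy
  have h1 : M x < M (x + 1) := hmono hx (show (0 : ℝ) < x + 1 by linarith) (by linarith)
  have h2 : M (x + 1) ≤ 0 := by
    refine ge_of_tendsto hlim ((eventually_ge_atTop (x + 1)).mono fun y hy => ?_)
    exact hmono.monotoneOn (show (0 : ℝ) < x + 1 by linarith)
      (show (0 : ℝ) < y by linarith) hy
  linarith

/-- For a solution `A` of Kummer's equation and `B = -A'`, this is `A²` times the derivative of
`B / (a A)`, with the derivative of `B` eliminated through the equation. -/
noncomputable def kummerSlope (a c : ℝ) (A B : ℝ → ℝ) (x : ℝ) : ℝ :=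
  B x ^ 2 / a - (c - x) * (A x * B x) / (a * x) - A x ^ 2 / x

/-- A positive decreasing solution `A` of Kummer's equation `x A'' + (c - x) A' - a A = 0` with
`B = -A'` and `x B < a A`. -/
structure KummerDecay (a c : ℝ) (A B : ℝ → ℝ) : Prop where
  deriv_fst : ∀ x, 0 < x → HasDerivAt A (-B x) x
  deriv_snd : ∀ x, 0 < x → HasDerivAt B (-(a * A x + (c - x) * B x) / x) x
  pos_fst : ∀ x, 0 < x → 0 < A x
  pos_snd : ∀ x, 0 < x → 0 < B x
  mul_lt : ∀ x, 0 < x → x * B x < a * A x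

namespace KummerDecay

variable {a c : ℝ} {A B f f' : ℝ → ℝ}

/-- The weight is `x` times the factor `x^c e^{-x}` that makes Kummer's equation self-adjoint; with
it the contribution of `S` collapses to `(B² + AB)/a`. -/
theorem hasDerivAt_comparison (h : KummerDecay a c A B) (ha : 0 < a)
    (hf : ∀ x, 0 < x → HasDerivAt f (f' x) x) {x : ℝ} (hx : 0 < x) :
    HasDerivAt (fun x => x ^ (c + 1) * Real.exp (-x) * (kummerSlope a c A B x - f x * A x ^ 2))
      (x ^ c * Real.exp (-x) * ((2 * x * A x * B x + (x - c - 1) * A x ^ 2) * f x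
        + (B x ^ 2 + A x * B x) / a - x * f' x * A x ^ 2)) x := by
  have hA := h.deriv_fst x hx
  have hB := h.deriv_snd x hx
  have e1 : HasDerivAt (fun x : ℝ => x ^ (c + 1)) ((c + 1) * x ^ (c + 1 - 1)) x :=
    Real.hasDerivAt_rpow_const (Or.inl hx.ne')
  have e2 : HasDerivAt (fun x : ℝ => Real.exp (-x)) (Real.exp (-x) * (-1)) x :=
    (hasDerivAt_id x).neg.exp
  have id := hasDerivAt_id' x
  have e3 := (((hB.pow 2).div_const a).sub
    (((id.const_sub c).mul (hA.mul hB)).div (id.const_mul a) (by positivity))).sub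
    ((hA.pow 2).div id hx.ne')
  refine ((e1.mul e2).mul (e3.sub ((hf x hx).mul (hA.pow 2)))).congr_deriv ?_
  simp only [Pi.mul_apply, Pi.sub_apply, Pi.pow_apply, Pi.div_apply, add_sub_cancel_right]
  rw [Real.rpow_add_one hx.ne']
  field_simp
  ring

/-- For `x ≥ 1`, monotonicity of `A` and `x B < a A` bound the last factor by a multiple of `A(1)²`,
and `e^{-x}` beats the power. -/
theorem tendsto_comparison (h : KummerDecay a c A B) (ha : 0 < a) {F : ℝ}
    (hF : ∀ x, 1 ≤ x → |f x| ≤ F) :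
    Tendsto (fun x => x ^ (c + 1) * Real.exp (-x) * (kummerSlope a c A B x - f x * A x ^ 2))
      atTop (𝓝 0) := by
  have hanti : AntitoneOn A (Ioi 0) := by
    refine antitoneOn_of_deriv_nonpos (convex_Ioi 0)
      (fun y hy => (h.deriv_fst y hy).continuousAt.continuousWithinAt) ?_ ?_
    · intro y hy
      rw [interior_Ioi] at hy
      exact (h.deriv_fst y hy).differentiableAt.differentiableWithinAt
    · intro y hy
      rw [interior_Ioi] at hy
      rw [(h.deriv_fst y hy).deriv]
      linarith [h.pos_snd y hy]
  have h0 : Tendsto (fun x : ℝ => x ^ (c + 1) * Real.exp (-x)) atTop (𝓝 0) := by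
    simpa using tendsto_rpow_mul_exp_neg_mul_atTop_nhds_zero (c + 1) 1 one_pos
  have h1 := h0.mul_const ((a + (|c| + 1) + 1 + F) * A 1 ^ 2)
  rw [zero_mul] at h1
  refine squeeze_zero_norm' ((eventually_ge_atTop 1).mono fun x hx => ?_) h1
  have hx0 : 0 < x := by linarith
  have hA := h.pos_fst x hx0
  have hB := h.pos_snd x hx0
  have hAB := h.mul_lt x hx0
  have hA1 : A x ≤ A 1 := hanti (by simp) hx0 hx
  have hBA : B x ≤ a * A x := by nlinarith
  rw [norm_mul, Real.norm_of_nonneg (by positivity : 0 ≤ x ^ (c + 1) * Real.exp (-x))]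
  refine mul_le_mul_of_nonneg_left ?_ (by positivity)
  have t1 : |B x ^ 2 / a| ≤ a * A x ^ 2 := by
    rw [abs_of_nonneg (by positivity), div_le_iff₀ ha]
    nlinarith
  have t2 : |(c - x) * (A x * B x) / (a * x)| ≤ (|c| + 1) * A x ^ 2 := by
    rw [abs_div, abs_mul, abs_of_pos (by positivity : 0 < A x * B x),
      abs_of_pos (by positivity : 0 < a * x), div_le_iff₀ (by positivity)]
    have : |c - x| ≤ (|c| + 1) * x := by
      calc |c - x| ≤ |c| + |x| := abs_sub c x
        _ ≤ (|c| + 1) * x := by rw [abs_of_pos hx0]; nlinarith [abs_nonneg c]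
    calc |c - x| * (A x * B x) ≤ (|c| + 1) * x * (A x * (a * A x)) := by gcongr
      _ = (|c| + 1) * A x ^ 2 * (a * x) := by ring
  have t3 : |A x ^ 2 / x| ≤ 1 * A x ^ 2 := by
    rw [abs_of_nonneg (by positivity), div_le_iff₀ hx0]
    nlinarith [sq_nonneg (A x)]
  have t4 : |f x * A x ^ 2| ≤ F * A x ^ 2 := by
    rw [abs_mul, abs_of_nonneg (sq_nonneg (A x))]
    gcongr
    exact hF x hx
  have hF0 : 0 ≤ F := (abs_nonneg _).trans (hF x hx)
  calc ‖kummerSlope a c A B x - f x * A x ^ 2‖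
      ≤ |B x ^ 2 / a| + |(c - x) * (A x * B x) / (a * x)| + |A x ^ 2 / x| + |f x * A x ^ 2| := by
        rw [Real.norm_eq_abs, kummerSlope]
        refine (abs_sub _ _).trans (add_le_add_left ((abs_sub _ _).trans ?_) _)
        exact add_le_add_left (abs_sub _ _) _
    _ ≤ (a + (|c| + 1) + 1 + F) * A x ^ 2 := by linarith
    _ ≤ (a + (|c| + 1) + 1 + F) * A 1 ^ 2 := by gcongr

theorem slope_lt (h : KummerDecay a c A B) (ha : 0 < a)
    (hf : ∀ x, 0 < x → HasDerivAt f (f' x) x) {F : ℝ} (hF : ∀ x, 1 ≤ x → |f x| ≤ F)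
    (hH : ∀ x, 0 < x → 0 < (2 * x * A x * B x + (x - c - 1) * A x ^ 2) * f x
        + (B x ^ 2 + A x * B x) / a - x * f' x * A x ^ 2) {x : ℝ} (hx : 0 < x) :
    kummerSlope a c A B x < f x * A x ^ 2 := by
  have := neg_of_hasDerivAt_pos_of_tendsto (fun y hy => h.hasDerivAt_comparison ha hf hy)
    (fun y hy => mul_pos (by positivity) (hH y hy)) (h.tendsto_comparison ha hF) hx
  have := neg_of_mul_neg_right this (by positivity)
  linarith

theorem lt_slope (h : KummerDecay a c A B) (ha : 0 < a)
    (hf : ∀ x, 0 < x → HasDerivAt f (f' x) x) {F : ℝ} (hF : ∀ x, 1 ≤ x → |f x| ≤ F)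
    (hH : ∀ x, 0 < x → (2 * x * A x * B x + (x - c - 1) * A x ^ 2) * f x
        + (B x ^ 2 + A x * B x) / a - x * f' x * A x ^ 2 < 0) {x : ℝ} (hx : 0 < x) :
    f x * A x ^ 2 < kummerSlope a c A B x := by
  have hlim := (h.tendsto_comparison ha hF).neg
  rw [neg_zero] at hlim
  have := neg_of_hasDerivAt_pos_of_tendsto (fun y hy => (h.hasDerivAt_comparison ha hf hy).neg)
    (fun y hy => by
      rw [← mul_neg]
      exact mul_pos (by positivity) (neg_pos.2 (hH y hy))) hlim hx
  have := neg_of_mul_neg_right ((mul_neg _ _).trans_lt this) (by positivity)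
  linarith

/-- From `-c B < a A` one gets `(B² + AB)/a < (a-c)/c² · A²`. With `f = -K`, the value of `K` is the
one for which the term `K (c+1) A²` cancels this bound; what remains is negative. -/
theorem neg_const_lt_slope (h : KummerDecay a c A B) (ha : 0 < a) (hc : c < -1)
    (hlow : ∀ x, 0 < x → 0 < a * A x + c * B x) {x : ℝ} (hx : 0 < x) :
    -((c - a) / (c ^ 2 * (c + 1))) * A x ^ 2 < kummerSlope a c A B x := by
  have hc1 : c + 1 < 0 := by linarith
  have hc2 : 0 < c ^ 2 := by nlinarith
  have hc0 : c ≠ 0 := by linarith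
  have hK : 0 < (c - a) / (c ^ 2 * (c + 1)) :=
    div_pos_of_neg_of_neg (by linarith) (mul_neg_of_pos_of_neg hc2 hc1)
  refine h.lt_slope ha (f := fun _ => -((c - a) / (c ^ 2 * (c + 1)))) (f' := fun _ => 0)
    (fun y _ => hasDerivAt_const y _) (F := (c - a) / (c ^ 2 * (c + 1))) ?_ (fun y hy => ?_) hx
  · intro y _
    rw [abs_neg, abs_of_pos hK]
  · have hA := h.pos_fst y hy
    have hB := h.pos_snd y hy
    have hl := hlow y hy
    have hKe : (c - a) / (c ^ 2 * (c + 1)) * (c + 1) = (c - a) / c ^ 2 := by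
      have := hc1.ne
      field_simp
    set K := (c - a) / (c ^ 2 * (c + 1)) with hKdef
    have b1 : (B y ^ 2 + A y * B y) / a < (a - c) / c ^ 2 * A y ^ 2 := by
      rw [div_mul_eq_mul_div, div_lt_div_iff₀ ha hc2]
      have p1 : (-c * B y) ^ 2 < (a * A y) ^ 2 := by
        have : 0 < -c * B y := mul_pos (by linarith) hB
        nlinarith
      have p2 : -c * (-c * B y) * A y < -c * (a * A y) * A y := by
        have : -c * B y < a * A y := by linarith
        have h3 : 0 < -c * A y := mul_pos (by linarith) hA
        nlinarith
      nlinarith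
    have b2 : (a - c) / c ^ 2 * A y ^ 2 = -(K * (c + 1)) * A y ^ 2 := by rw [hKe]; ring
    have b3 : 0 < K * (2 * y * A y * B y + y * A y ^ 2) := by positivity
    simp only [mul_zero, zero_mul, sub_zero]
    nlinarith

theorem neg_inv_lt_slope (h : KummerDecay a c A B) (ha : 0 < a) (hc : c < 0)
    (hlow : ∀ x, 0 < x → 0 < a * A x + c * B x) {x : ℝ} (hx : 0 < x) :
    1 / (2 * c) / x * A x ^ 2 < kummerSlope a c A B x := by
  -- For `f = κ/x` the form contains `2κAB + B²/a = B (2κ a A + B)/a`, a multiple of `a A + c B`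
  -- precisely when `κ = 1/(2c)`.
  refine h.lt_slope ha (f := fun x => 1 / (2 * c) / x)
    (f' := fun x => -(1 / (2 * c)) / x ^ 2) ?_ (F := |1 / (2 * c)|) ?_ (fun y hy => ?_) hx
  · intro y hy
    refine ((hasDerivAt_const y (1 / (2 * c))).div (hasDerivAt_id' y) hy.ne').congr_deriv ?_
    ring
  · intro y hy
    rw [abs_div]
    exact div_le_self (abs_nonneg _) (hy.trans (le_abs_self y))
  · have hA := h.pos_fst y hy
    have hB := h.pos_snd y hy
    have hl := hlow y hy
    have hm := h.mul_lt y hy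
    have e : (2 * y * A y * B y + (y - c - 1) * A y ^ 2) * (1 / (2 * c) / y)
        + (B y ^ 2 + A y * B y) / a - y * (-(1 / (2 * c)) / y ^ 2) * A y ^ 2
        = (y * (2 * B y + A y) * (a * A y + c * B y) + (-c) * A y * (a * A y - y * B y))
          / (2 * a * c * y) := by
      have := hc.ne
      field_simp
      ring
    rw [e]
    refine div_neg_of_pos_of_neg ?_ ?_
    · have : 0 < -c := by linarith
      have : 0 < a * A y - y * B y := by linarith
      positivity
    · have : 0 < a * y := by positivity
      nlinarith

/-- This `f` is the solution of `1 + x² f = 2(1+a-c)/x`. In terms of `aA - xB` the quadratic form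
becomes a sum of positive terms. -/
theorem slope_lt_inv_sq (h : KummerDecay a c A B) (ha : 0 < a) (hc : c < 1)
    (hup : ∀ x, 0 < x → x * (a * A x - x * B x) < (1 + a - c) * (a * A x)) {x : ℝ} (hx : 0 < x) :
    (-1 + 2 * (1 + a - c) / x) / x ^ 2 * A x ^ 2 > kummerSlope a c A B x := by
  have hb : 0 < 1 + a - c := by linarith
  refine h.slope_lt ha (f := fun x => (-1 + 2 * (1 + a - c) / x) / x ^ 2)
    (f' := fun x => 2 / x ^ 3 - 6 * (1 + a - c) / x ^ 4) ?_
    (F := 1 + 2 * (1 + a - c)) ?_ (fun y hy => ?_) hx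
  · intro y hy
    have id := hasDerivAt_id' y
    refine ((((hasDerivAt_const y (2 * (1 + a - c))).div id hy.ne').const_add (-1)).div
      (id.pow 2) (pow_ne_zero 2 hy.ne')).congr_deriv ?_
    simp only [Pi.pow_apply, Pi.div_apply]
    field_simp
    ring
  · intro y hy
    have hy0 : 0 < y := by linarith
    rw [abs_div, abs_of_pos (by positivity : 0 < y ^ 2)]
    refine (div_le_self (abs_nonneg _) (by nlinarith)).trans ((abs_add_le _ _).trans ?_)
    rw [abs_neg, abs_one, abs_of_pos (by positivity : 0 < 2 * (1 + a - c) / y)]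
    gcongr
    exact div_le_self (by positivity) hy
  · have hA := h.pos_fst y hy
    have hB := h.pos_snd y hy
    have hu := hup y hy
    have e : (2 * y * A y * B y + (y - c - 1) * A y ^ 2) * ((-1 + 2 * (1 + a - c) / y) / y ^ 2)
        + (B y ^ 2 + A y * B y) / a - y * (2 / y ^ 3 - 6 * (1 + a - c) / y ^ 4) * A y ^ 2
        = (A y * ((1 + a - c) * (a * A y) - y * (a * A y - y * B y)) + (a * A y - y * B y) ^ 2
          + 2 * (1 + a - c) * a / y * (2 * y * A y * B y + (2 - c) * A y ^ 2)) / (a * y ^ 2) := by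
      field_simp
      ring
    simp only [e]
    have h1 : 0 < (1 + a - c) * (a * A y) - y * (a * A y - y * B y) := by linarith
    have h2 : 0 < 2 - c := by linarith
    positivity

end KummerDecay

/-! ### Linear inequalities from contiguous relations. -/

section Contiguous

variable {a c x : ℝ}

theorem mul_laplaceBeta_sub_one_right (ha : 0 < a) (c : ℝ) (hx : 0 < x) :
    (1 + a - c) * laplaceBeta a (c - a - 1 - 1) x
      = a * laplaceBeta (a - 1) (c - a - 1) x - x * laplaceBeta a (c - a - 1) x := by
  linear_combination mul_laplaceBeta ha (c - a - 1) hx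

/-- Kummer's equation for the integral. -/
theorem laplaceBeta_kummer (ha : 0 < a) (c : ℝ) (hx : 0 < x) :
    x * laplaceBeta (a + 1) (c - a - 1) x
      = a * laplaceBeta (a - 1) (c - a - 1) x + (c - x) * laplaceBeta a (c - a - 1) x := by
  have h1 := mul_laplaceBeta ha (c - a - 1 + 1) hx
  rw [laplaceBeta_add_one_right (by linarith) _ hx, laplaceBeta_add_one_right (by linarith) _ hx,
    sub_add_cancel, add_sub_cancel_right] at h1
  linear_combination h1

/-- Kummer's equation reads `a A + c B = x (B + A'')`, and both `B` and `A''` are positive. -/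
theorem laplaceBeta_lower (ha : 0 < a) (c : ℝ) (hx : 0 < x) :
    0 < a * laplaceBeta (a - 1) (c - a - 1) x + c * laplaceBeta a (c - a - 1) x := by
  have h1 := laplaceBeta_kummer ha c hx
  have h2 := laplaceBeta_pos (p := a) (by linarith) (c - a - 1) hx
  have h3 := laplaceBeta_pos (p := a + 1) (by linarith) (c - a - 1) hx
  have : 0 < x * (laplaceBeta a (c - a - 1) x + laplaceBeta (a + 1) (c - a - 1) x) := by positivity
  linarith

theorem kummerDecay_laplaceBeta (ha : 0 < a) (hc : c < 1 + a) :
    KummerDecay a c (laplaceBeta (a - 1) (c - a - 1)) (laplaceBeta a (c - a - 1)) where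
  deriv_fst x hx := by
    simpa using hasDerivAt_laplaceBeta (p := a - 1) (by linarith) (c - a - 1) hx
  deriv_snd x hx := by
    refine (hasDerivAt_laplaceBeta (p := a) (by linarith) (c - a - 1) hx).congr_deriv ?_
    rw [← laplaceBeta_kummer ha c hx]
    field_simp
  pos_fst x hx := laplaceBeta_pos (by linarith) _ hx
  pos_snd x hx := laplaceBeta_pos (by linarith) _ hx
  mul_lt x hx := by
    have h1 := mul_laplaceBeta_sub_one_right ha c hx
    have h2 : 0 < (1 + a - c) * laplaceBeta a (c - a - 1 - 1) x :=
      mul_pos (by linarith) (laplaceBeta_pos (by linarith) _ hx)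
    linarith

/-- Lowering the exponent of `1 + t` decreases the integral, so this follows from `x B < a A`. -/
theorem mul_laplaceBeta_sub_one_lt (ha : 0 < a) (hc : c < 1 + a) (hx : 0 < x) :
    x * laplaceBeta a (c - a - 1 - 1) x < a * laplaceBeta (a - 1) (c - a - 1) x := by
  have h1 := laplaceBeta_add_one_right (p := a) (by linarith) (c - a - 1 - 1) hx
  rw [sub_add_cancel] at h1
  have h2 := laplaceBeta_pos (p := a + 1) (by linarith) (c - a - 1 - 1) hx
  have h3 := (kummerDecay_laplaceBeta ha hc).mul_lt x hx
  nlinarith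

end Contiguous

/-! ### Bounds and limits of the normalized Turánian. -/

/-- `(1 + a - c)` times the Turánian divided by the square of the Tricomi function. -/
noncomputable def turanianRatio (a c x : ℝ) : ℝ :=
  1 + x ^ 2 * (kummerSlope a c (laplaceBeta (a - 1) (c - a - 1)) (laplaceBeta a (c - a - 1)) x
    / laplaceBeta (a - 1) (c - a - 1) x ^ 2)

section Ratio

variable {a c x : ℝ}

theorem tricomi_pos (ha : 0 < a) (c : ℝ) (hx : 0 < x) : 0 < tricomi a c x := by
  rw [tricomi_eq_laplaceBeta ha]
  exact mul_pos (one_div_pos.2 (Real.Gamma_pos_of_pos ha)) (laplaceBeta_pos (by linarith) _ hx)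

theorem turanianFst_eq_ratio (ha : 0 < a) (hc : c < 1 + a) (hx : 0 < x) :
    turanianFst a c x = 1 / (1 + a - c) * turanianRatio a c x * tricomi a c x ^ 2 := by
  have hb : 1 + a - c ≠ 0 := by linarith
  have hA := laplaceBeta_pos (p := a - 1) (by linarith) (c - a - 1) hx
  have hD : laplaceBeta a (c - a - 1 - 1) x = (a * laplaceBeta (a - 1) (c - a - 1) x
      - x * laplaceBeta a (c - a - 1) x) / (1 + a - c) := by
    rw [← mul_laplaceBeta_sub_one_right ha c hx]
    field_simp
  have hG := (Real.Gamma_pos_of_pos ha).ne'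
  rw [turanianFst_eq ha hx, hD, tricomi_eq_laplaceBeta ha, turanianRatio, kummerSlope]
  field_simp
  ring

theorem turanianRatio_lt (ha : 0 < a) (hc : c < 1) (hx : 0 < x) :
    turanianRatio a c x < 2 * (1 + a - c) / x := by
  have hA := laplaceBeta_pos (p := a - 1) (by linarith) (c - a - 1) hx
  have h := (kummerDecay_laplaceBeta ha (by linarith)).slope_lt_inv_sq ha hc (fun y hy => by
    rw [← mul_laplaceBeta_sub_one_right ha c hy]
    have := mul_laplaceBeta_sub_one_lt ha (by linarith : c < 1 + a) hy
    nlinarith) hx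
  rw [gt_iff_lt, ← div_lt_iff₀ (by positivity)] at h
  have h2 := mul_lt_mul_of_pos_left h (by positivity : 0 < x ^ 2)
  rw [mul_div_cancel₀ _ (by positivity)] at h2
  rw [turanianRatio]
  linarith

theorem lt_turanianRatio_of_neg (ha : 0 < a) (hc : c < 0) (hx : 0 < x) :
    1 + 1 / (2 * c) * x < turanianRatio a c x := by
  have hA := laplaceBeta_pos (p := a - 1) (by linarith) (c - a - 1) hx
  have h := (kummerDecay_laplaceBeta ha (by linarith)).neg_inv_lt_slope ha hc
    (fun y hy => laplaceBeta_lower ha c hy) hx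
  rw [← lt_div_iff₀ (by positivity)] at h
  have h2 := mul_lt_mul_of_pos_left h (by positivity : 0 < x ^ 2)
  have h3 : x ^ 2 * (1 / (2 * c) / x) = 1 / (2 * c) * x := by field_simp
  rw [turanianRatio]
  linarith

theorem lt_turanianRatio_of_lt_neg_one (ha : 0 < a) (hc : c < -1) (hx : 0 < x) :
    1 - (c - a) / (c ^ 2 * (c + 1)) * x ^ 2 < turanianRatio a c x := by
  have hA := laplaceBeta_pos (p := a - 1) (by linarith) (c - a - 1) hx
  have h := (kummerDecay_laplaceBeta ha (by linarith)).neg_const_lt_slope ha hc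
    (fun y hy => laplaceBeta_lower ha c hy) hx
  rw [← lt_div_iff₀ (by positivity)] at h
  have h2 := mul_lt_mul_of_pos_left h (by positivity : 0 < x ^ 2)
  rw [turanianRatio]
  linarith

theorem tendsto_turanianRatio_zero (ha : 0 < a) (hc : c < 0) :
    Tendsto (turanianRatio a c) (𝓝[>] 0) (𝓝 1) := by
  set A := laplaceBeta (a - 1) (c - a - 1) with hAdef
  set B := laplaceBeta a (c - a - 1) with hBdef
  have hid : Tendsto (fun x : ℝ => x) (𝓝[>] 0) (𝓝 0) := nhdsWithin_le_nhds
  -- `a A + c B > 0` squeezes `x B/(aA)` between `0` and `x/(-c)`; the ratio is a polynomial in this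
  -- quantity and `x`.
  have hz : Tendsto (fun x => x * B x / (a * A x)) (𝓝[>] 0) (𝓝 0) := by
    have h1 : Tendsto (fun x : ℝ => x / -c) (𝓝[>] 0) (𝓝 0) := by
      simpa using hid.div_const (-c)
    refine squeeze_zero' ?_ ?_ h1
    all_goals
      filter_upwards [self_mem_nhdsWithin] with x hx
      have hx0 : (0 : ℝ) < x := hx
      have hA : 0 < A x := laplaceBeta_pos (by linarith) _ hx0
      have hB : 0 < B x := laplaceBeta_pos (by linarith) _ hx0
    · positivity
    · have hl : 0 < a * A x + c * B x := laplaceBeta_lower ha c hx0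
      rw [div_le_div_iff₀ (by positivity) (by linarith)]
      nlinarith
  have h : Tendsto (fun x => 1 + a * (x * B x / (a * A x)) ^ 2
      - (c - x) * (x * B x / (a * A x)) - x) (𝓝[>] 0)
      (𝓝 (1 + a * 0 ^ 2 - (c - 0) * 0 - 0)) :=
    (((hz.pow 2).const_mul a).const_add 1 |>.sub ((hid.const_sub c).mul hz)).sub hid
  simp only [ne_eq, OfNat.ofNat_ne_zero, not_false_eq_true, zero_pow, mul_zero, add_zero,
    sub_zero] at h
  refine h.congr' ?_
  filter_upwards [self_mem_nhdsWithin] with x hx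
  have hx0 : (0 : ℝ) < x := hx
  have hA : 0 < A x := laplaceBeta_pos (by linarith) _ hx0
  rw [turanianRatio, kummerSlope, ← hAdef, ← hBdef]
  field_simp
  ring

/-- First-order asymptotics of the ratio of contiguous integrals. -/
theorem tendsto_mul_laplaceBeta_div (ha : 0 < a) (hc : c < 1 + a) :
    Tendsto (fun x => x * laplaceBeta a (c - a - 1) x / (a * laplaceBeta (a - 1) (c - a - 1) x))
      atTop (𝓝 1) := by
  have h1 : Tendsto (fun x : ℝ => 1 - (1 + a - c) / x) atTop (𝓝 1) := by
    simpa using (tendsto_const_nhds (x := (1 + a - c))).div_atTop tendsto_id |>.const_sub (1 : ℝ)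
  refine tendsto_of_tendsto_of_tendsto_of_le_of_le' h1 tendsto_const_nhds ?_ ?_
  all_goals
    filter_upwards [eventually_gt_atTop 0] with x hx
    have hA := laplaceBeta_pos (p := a - 1) (by linarith) (c - a - 1) hx
  · have h2 := mul_laplaceBeta_sub_one_right ha c hx
    have h3 := mul_laplaceBeta_sub_one_lt ha hc hx
    rw [one_sub_div hx.ne', div_le_div_iff₀ hx (by positivity)]
    nlinarith
  · rw [div_le_one (by positivity)]
    exact ((kummerDecay_laplaceBeta ha hc).mul_lt x hx).le

theorem tendsto_mul_turanianRatio_atTop (ha : 0 < a) (hc : c < 1) :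
    Tendsto (fun x => x * turanianRatio a c x) atTop (𝓝 (2 * (1 + a - c))) := by
  set A := laplaceBeta (a - 1) (c - a - 1) with hAdef
  set D := laplaceBeta a (c - a - 1 - 1) with hDdef
  set E := laplaceBeta (a + 1) (c - a - 1 - 1) with hEdef
  have hinv : Tendsto (fun x : ℝ => x⁻¹) atTop (𝓝 0) := tendsto_inv_atTop_zero
  have hE : Tendsto (fun x => x * E x / ((a + 1) * D x)) atTop (𝓝 1) := by
    have := tendsto_mul_laplaceBeta_div (a := a + 1) (c := c) (by linarith) (by linarith)
    rwa [add_sub_cancel_right, ← sub_sub c a 1] at this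
  -- `1 - v`, where `v = x D / (a A)`, in terms of `v` itself
  have hpos : ∀ x, 0 < x → 0 < A x ∧ 0 < D x := fun x hx =>
    ⟨laplaceBeta_pos (by linarith) _ hx, laplaceBeta_pos (by linarith) _ hx⟩
  have hsub : ∀ x, 0 < x → x * (1 - x * D x / (a * A x))
      = x * D x / (a * A x) * (1 + a - c + (a + 1) * (x * E x / ((a + 1) * D x))) := by
    intro x hx
    obtain ⟨hA, hD⟩ := hpos x hx
    have h1 := mul_laplaceBeta_sub_one_right ha c hx
    have h2 := laplaceBeta_add_one_right (p := a) (by linarith) (c - a - 1 - 1) hx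
    rw [sub_add_cancel] at h2
    rw [h2] at h1
    have h3 : (1 + a - c) * D x = a * A x - x * (D x + E x) := h1
    have ha1 : a + 1 ≠ 0 := by linarith
    field_simp
    linear_combination -h3
  -- `v ≤ 1` in the identity above gives `1 - v ≤ q/x` with `q` convergent.
  have hv : Tendsto (fun x => x * D x / (a * A x)) atTop (𝓝 1) := by
    have h1 : Tendsto (fun x => 1 - x⁻¹ * (1 + a - c + (a + 1) * (x * E x / ((a + 1) * D x))))
        atTop (𝓝 (1 - 0 * (1 + a - c + (a + 1) * 1))) :=
      (hinv.mul ((hE.const_mul (a + 1)).const_add (1 + a - c))).const_sub 1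
    rw [zero_mul, sub_zero] at h1
    refine tendsto_of_tendsto_of_tendsto_of_le_of_le' h1 tendsto_const_nhds ?_ ?_
    all_goals
      filter_upwards [eventually_gt_atTop 0] with x hx
      obtain ⟨hA, hD⟩ := hpos x hx
      have hv1 : x * D x / (a * A x) ≤ 1 := by
        rw [div_le_one (by positivity)]
        exact (mul_laplaceBeta_sub_one_lt ha (by linarith : c < 1 + a) hx).le
    · have hE0 : 0 < E x := laplaceBeta_pos (by linarith) _ hx
      have hq : 0 < 1 + a - c + (a + 1) * (x * E x / ((a + 1) * D x)) :=
        add_pos (by linarith) (by positivity)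
      have h2 : 1 - x * D x / (a * A x) = x⁻¹ * (x * D x / (a * A x)
          * (1 + a - c + (a + 1) * (x * E x / ((a + 1) * D x)))) := by
        rw [← hsub x hx, inv_mul_cancel_left₀ hx.ne']
      have h3 := mul_le_mul_of_nonneg_left (mul_le_mul_of_nonneg_right hv1 hq.le)
        (inv_pos.2 hx).le
      rw [← h2, one_mul] at h3
      linarith
    · exact hv1
  -- These summands are `x` times the ratio, written through `x (1 - v)`, `v` and `1/x`. The factor
  -- `x` calls for the limit of `x (1 - v)`, not just `v → 1`.
  have h : Tendsto (fun x => (1 + a - c) * (x * D x / (a * A x)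
        * (1 + a - c + (a + 1) * (x * E x / ((a + 1) * D x))))
      + (c - 2 * a) * (1 + a - c) * (x * D x / (a * A x))
      + a * (1 + a - c) ^ 2 * (x * D x / (a * A x)) ^ 2 * x⁻¹) atTop
      (𝓝 ((1 + a - c) * (1 * (1 + a - c + (a + 1) * 1)) + (c - 2 * a) * (1 + a - c) * 1
        + a * (1 + a - c) ^ 2 * 1 ^ 2 * 0)) :=
    (((hv.mul ((hE.const_mul (a + 1)).const_add (1 + a - c))).const_mul (1 + a - c)).add
      (hv.const_mul _)).add (((hv.pow 2).const_mul _).mul hinv)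
  rw [show (1 + a - c) * (1 * (1 + a - c + (a + 1) * 1)) + (c - 2 * a) * (1 + a - c) * 1
    + a * (1 + a - c) ^ 2 * 1 ^ 2 * 0 = 2 * (1 + a - c) by ring] at h
  refine h.congr' ?_
  filter_upwards [eventually_gt_atTop 0] with x hx
  obtain ⟨hA, hD⟩ := hpos x hx
  have hB : laplaceBeta a (c - a - 1) x = (a * A x - (1 + a - c) * D x) / x := by
    rw [eq_div_iff hx.ne']
    linear_combination mul_laplaceBeta_sub_one_right ha c hx
  rw [← hsub x hx, turanianRatio, kummerSlope, ← hAdef, hB]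
  field_simp
  ring

end Ratio

/-! ### Asymptotic equivalence and the main theorem. -/

/-- Two bounds whose coefficients have the same nonzero limit are equivalent. -/
theorem isEquivalent_turanianFst {a c L : ℝ} {l : Filter ℝ} (hl : ∀ᶠ x in l, 0 < x) (ha : 0 < a)
    (hc : c < 1 + a) (hL : L ≠ 0) {g β : ℝ → ℝ}
    (hg : ∀ᶠ x in l, g x ≠ 0)
    (hr : Tendsto (fun x => g x * (1 / (1 + a - c) * turanianRatio a c x)) l (𝓝 L))
    (hβ : Tendsto (fun x => g x * β x) l (𝓝 L)) :
    Asymptotics.IsEquivalent l (fun x => turanianFst a c x)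
      (fun x => β x * tricomi a c x ^ 2) := by
  have h1 := ((Asymptotics.isEquivalent_const_iff_tendsto hL).2 hr).trans
    ((Asymptotics.isEquivalent_const_iff_tendsto hL).2 hβ).symm
  have h2 : Asymptotics.IsEquivalent l (fun x => (g x)⁻¹ * tricomi a c x ^ 2)
    (fun x => (g x)⁻¹ * tricomi a c x ^ 2) := Asymptotics.IsEquivalent.refl
  refine ((h1.mul h2).congr_left ?_).congr_right ?_
  · filter_upwards [hl, hg] with x hx hgx
    simp only [Pi.mul_apply]
    rw [turanianFst_eq_ratio ha hc hx]
    field_simp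
  · filter_upwards [hg] with x hgx
    simp only [Pi.mul_apply]
    field_simp

theorem isEquivalent_turanianFst_zero {a c : ℝ} (ha : 0 < a) (hc : c < 0) {k : ℝ → ℝ}
    (hk : Continuous k) (hk0 : k 0 = 1) :
    Asymptotics.IsEquivalent (𝓝[>] (0 : ℝ)) (fun x => turanianFst a c x)
      (fun x => 1 / (1 + a - c) * k x * tricomi a c x ^ 2) := by
  have hb : 1 / (1 + a - c) ≠ 0 := one_div_ne_zero (by linarith)
  refine isEquivalent_turanianFst (l := 𝓝[>] 0) (L := 1 / (1 + a - c)) (g := fun _ => 1)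
    (β := fun x => 1 / (1 + a - c) * k x)
    (eventually_mem_nhdsWithin (s := Ioi 0)) ha (by linarith) hb (by simp) ?_ ?_
  · simpa using (tendsto_turanianRatio_zero ha hc).const_mul (1 / (1 + a - c))
  · have h0 : Tendsto k (𝓝[>] 0) (𝓝 1) := hk0 ▸ (hk.tendsto 0).mono_left nhdsWithin_le_nhds
    simpa using h0.const_mul (1 / (1 + a - c))

theorem turanianFst_lt {a c x : ℝ} (ha : 0 < a) (hc : c < 1) (hx : 0 < x) :
    turanianFst a c x < 2 / x * tricomi a c x ^ 2 := by
  rw [turanianFst_eq_ratio ha (by linarith) hx]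
  refine mul_lt_mul_of_pos_right ?_ (pow_pos (tricomi_pos ha c hx) 2)
  rw [one_div_mul_eq_div, div_lt_iff₀ (by linarith)]
  exact (turanianRatio_lt ha hc hx).trans_eq (by ring)

theorem lt_turanianFst {a c x k : ℝ} (ha : 0 < a) (hc : c < 1 + a) (hx : 0 < x)
    (hk : k < turanianRatio a c x) :
    1 / (1 + a - c) * k * tricomi a c x ^ 2 < turanianFst a c x := by
  rw [turanianFst_eq_ratio ha hc hx]
  exact mul_lt_mul_of_pos_right (mul_lt_mul_of_pos_left hk (one_div_pos.2 (by linarith)))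
    (pow_pos (tricomi_pos ha c hx) 2)

theorem theorem2 :
    (∀ a c : ℝ, 0 < a → c < 0 →
      (∀ x : ℝ, 0 < x →
        1 / (1 + a - c) * (1 + 1 / (2 * c) * x) * tricomi a c x ^ 2 < turanianFst a c x ∧
        turanianFst a c x < 2 / x * tricomi a c x ^ 2) ∧
      Asymptotics.IsEquivalent (𝓝[>] (0 : ℝ))
        (fun x : ℝ => turanianFst a c x)
        (fun x : ℝ => 1 / (1 + a - c) * (1 + 1 / (2 * c) * x) * tricomi a c x ^ 2)) ∧
    (∀ a c : ℝ, 0 < a → c < 1 →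
      (∀ x : ℝ, 0 < x → turanianFst a c x < 2 / x * tricomi a c x ^ 2) ∧
      Asymptotics.IsEquivalent atTop
        (fun x : ℝ => turanianFst a c x)
        (fun x : ℝ => 2 / x * tricomi a c x ^ 2)) ∧
    (∀ a c : ℝ, 1 < a → c < -1 →
      (∀ x : ℝ, 0 < x →
        1 / (1 + a - c) * (1 - (c - a) / (c ^ 2 * (c + 1)) * x ^ 2) * tricomi a c x ^ 2
          < turanianFst a c x) ∧
      Asymptotics.IsEquivalent (𝓝[>] (0 : ℝ))
        (fun x : ℝ => turanianFst a c x)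
        (fun x : ℝ =>
          1 / (1 + a - c) * (1 - (c - a) / (c ^ 2 * (c + 1)) * x ^ 2) * tricomi a c x ^ 2)) := by
  refine ⟨fun a c ha hc => ⟨fun x hx => ⟨?_, turanianFst_lt ha (by linarith) hx⟩, ?_⟩,
    fun a c ha hc => ⟨fun x hx => turanianFst_lt ha hc hx, ?_⟩,
    fun a c ha hc => ⟨fun x hx => ?_, ?_⟩⟩
  · exact lt_turanianFst ha (by linarith) hx (lt_turanianRatio_of_neg ha hc hx)
  · exact isEquivalent_turanianFst_zero ha hc (k := fun x => 1 + 1 / (2 * c) * x) (by fun_prop)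
      (by simp)
  · have hb : 1 + a - c ≠ 0 := by linarith
    -- Both coefficients tend to `0` at infinity; multiplying by `g = x` gives them the nonzero
    -- limit `2`.
    refine isEquivalent_turanianFst (L := 2) (g := fun x => x) (β := fun x => 2 / x)
      (eventually_gt_atTop 0) ha (by linarith) two_ne_zero (eventually_ne_atTop 0) ?_ ?_
    · have h := (tendsto_mul_turanianRatio_atTop ha hc).const_mul (1 / (1 + a - c))
      rw [show 1 / (1 + a - c) * (2 * (1 + a - c)) = 2 by field_simp] at h
      exact h.congr fun x => by ring
    · refine tendsto_const_nhds.congr' ?_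
      filter_upwards [eventually_ne_atTop 0] with x hx
      field_simp
  · exact lt_turanianFst (by linarith) (by linarith) hx
      (lt_turanianRatio_of_lt_neg_one (by linarith) hc hx)
  · exact isEquivalent_turanianFst_zero (by linarith) (by linarith)
      (k := fun x => 1 - (c - a) / (c ^ 2 * (c + 1)) * x ^ 2) (by fun_prop) (by simp)
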